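/- Theorem 3.3 (Elimination criterion). Let $m,n\ge 0$ be integers and let $G=([m],E)$ be an undirected graph on $[m]=\{1,\dots,m\}$, where by convention $E$ contains all self-loops $(i,i)$. Let $S=(s_{ij})$ be the symmetric $m\times m$ matrix of unknowns ($s_{ij}=s_{ji}$), let $J\subseteq\mathbb{R}[s_{ij}: 1\le i\le j\le m]$ be the ideal generated by the $(n+1)\times(n+1)$ minors of $S$, and let $$I_{G,n}=J\cap\mathbb{R}[s_{ij}:(i,j)\in E]$$ be the elimination ideal obtained by eliminating the unknowns corresponding to the non-edges of $G$. Let $$\mathcal{M}_G=\{\Sigma\in\mathbb{R}^{m\times m}: \Sigma \text{ symmetric positive definite},\ (\Sigma^{-1})_{ij}=0 \text{ for all } (i,j)\notin E\}$$ be the set of covariance matrices of the (mean-zero) Gaussian graphical model on $G$. For observations $x_1,\dots,x_n\in\mathbb{R}^m$, the maximum likelihood estimator (MLE) is said to exist if the likelihood function $$\Sigma\mapsto\prod_{k=1}^n (2\pi)^{-m/2}(\det\Sigma)^{-1/2}\exp\left(-\tfrac12 x_k^T\Sigma^{-1}x_k\right)$$ attains its maximum over $\mathcal{M}_G$. If $I_{G,n}$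 is the zero ideal, then for every $\Sigma_0\in\mathcal{M}_G$ and all independent random vectors $X_1,\dots,X_n$ with distribution $\mathcal{N}(0,\Sigma_0)$, the MLE for the observations $X_1,\dots,X_n$ exists with probability one. -/

import Mathlib

open MeasureTheory ProbabilityTheory
open scoped Matrix

noncomputable section

namespace GaussianGraphicalModel

/-- The generic symmetric `m × m` matrix: its `(i, j)` entry is the unknown `s_{ij} = s_{ji}`.
The unknowns are indexed by unordered pairs, diagonal pairs included. -/
def genericSymm (m : ℕ) : Matrix (Fin m) (Fin m) (MvPolynomial (Sym2 (Fin m)) ℝ) :=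
  Matrix.of fun i j => MvPolynomial.X s(i, j)

/-- The ideal generated by the `k × k` minors of the generic symmetric `m × m` matrix. -/
def minorIdeal (m k : ℕ) : Ideal (MvPolynomial (Sym2 (Fin m)) ℝ) :=
  Ideal.span {p | ∃ r c : Fin k ↪o Fin m, p = ((genericSymm m).submatrix r c).det}

/-- The edges of `G` together with all self-loops. -/
def edgesWithLoops {m : ℕ} (G : SimpleGraph (Fin m)) : Set (Sym2 (Fin m)) :=
  {e | e.IsDiag ∨ e ∈ G.edgeSet}

/-- The elimination ideal `I_{G,n}`: the polynomials in the unknowns indexed by edges and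
self-loops of `G` which lie in the ideal of `(n+1) × (n+1)` minors. -/
def eliminationIdeal {m : ℕ} (G : SimpleGraph (Fin m)) (n : ℕ) :
    Ideal (MvPolynomial (edgesWithLoops G) ℝ) :=
  (minorIdeal m (n + 1)).comap
    (MvPolynomial.rename (R := ℝ) (Subtype.val : edgesWithLoops G → Sym2 (Fin m)))

/-- The covariance matrices of the Gaussian graphical model on `G`: positive definite matrices
whose inverse vanishes at all non-edges (self-loops counting as edges). -/
def covModel {m : ℕ} (G : SimpleGraph (Fin m)) : Set (Matrix (Fin m) (Fin m) ℝ) :=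
  {S | S.PosDef ∧ ∀ i j, i ≠ j → ¬ G.Adj i j → S⁻¹ i j = 0}

/-- The Lebesgue density of `N(0, S)` on `ℝ^m`, for `S` positive definite. -/
def gaussianDensity {m : ℕ} (S : Matrix (Fin m) (Fin m) ℝ) (x : EuclideanSpace ℝ (Fin m)) : ℝ :=
  (Real.sqrt ((2 * Real.pi) ^ m * S.det))⁻¹ *
    Real.exp (-((fun i => x i) ⬝ᵥ (S⁻¹ *ᵥ fun i => x i)) / 2)

/-- The likelihood of the covariance matrix `S` given the observations `x 0, …, x (n-1)`. -/
def likelihood {m n : ℕ} (x : Fin n → EuclideanSpace ℝ (Fin m))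
    (S : Matrix (Fin m) (Fin m) ℝ) : ℝ :=
  ∏ k, gaussianDensity S (x k)

/-- The maximum likelihood estimator for the observations `x` exists: the likelihood attains its
maximum over the Gaussian graphical model on `G`. -/
def MLEExists {m n : ℕ} (G : SimpleGraph (Fin m)) (x : Fin n → EuclideanSpace ℝ (Fin m)) : Prop :=
  ∃ S ∈ covModel G, IsMaxOn (likelihood x) (covModel G) S

end GaussianGraphicalModel

end

/-! Work with precision matrices `K = Σ⁻¹`. The likelihood is a power of `det K` times the
exponential of a linear form in `K`, so it attains its maximum as soon as that form is coercive on
the closed cone of positive semidefinite `K` supported on `G`. By compactness this holds if no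
nonzero symmetric `K` supported on `G` kills every observation.

That condition is generic. Since the elimination ideal is zero, some symmetric `S` of rank at most
`n`, over an algebraically closed field containing `ℝ`, has algebraically independent entries at the
edges and loops. Write `S = Y * Yᵀ`, and let `D` be a derivation dual to one such entry. If `K * Y =
0`, the Leibniz rule gives `∑ K i j * D (S i j) = 0`, while the left side is the chosen entry of
`K`, counted once or twice; hence `K = 0` (`eq_zero_of_symmOfSupport_mul_eq_zero`). So `K ↦ K * Y`
is injective for one `Y`, and a maximal minor of this map is a nonzero polynomial in `Y`. Nonzero
real polynomials vanish with Gaussian probability zero. -/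

/-! ### Derivations dual to algebraically independent elements -/

/-- Derivations extend along formally étale algebras. -/
theorem Derivation.exists_extension_of_formallyEtale {k A L : Type*} [CommRing k] [CommRing A]
    [CommRing L] [Algebra k A] [Algebra k L] [Algebra A L] [IsScalarTower k A L]
    [Algebra.FormallyEtale A L] (d : Derivation k A L) :
    ∃ D : Derivation k L L, ∀ a, D (algebraMap A L a) = d a := by
  refine ⟨((d.liftKaehlerDifferential.liftBaseChange L) ∘ₗ
    (KaehlerDifferential.tensorKaehlerEquivOfFormallyEtale k A L).symm.toLinearMap).compDer
      (KaehlerDifferential.D k L), fun a => ?_⟩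
  change d.liftKaehlerDifferential.liftBaseChange L
    ((KaehlerDifferential.tensorKaehlerEquivOfFormallyEtale k A L).symm
      (KaehlerDifferential.D k L (algebraMap A L a))) = _
  rw [KaehlerDifferential.tensorKaehlerEquivOfFormallyEtale_symm_D_algebraMap]
  simp only [LinearMap.liftBaseChange_tmul, Derivation.liftKaehlerDifferential_comp_D, one_smul]

/-- A field algebraic over a subdomain of characteristic zero is formally étale over it. -/
theorem Algebra.FormallyEtale.of_isAlgebraic_of_charZero (A L : Type*) [CommRing A] [IsDomain A]
    [CharZero A] [Field L] [Algebra A L] [FaithfulSMul A L] [Algebra.IsAlgebraic A L] :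
    Algebra.FormallyEtale A L := by
  let : Algebra (FractionRing A) L := FractionRing.liftAlgebra A L
  have : IsScalarTower A (FractionRing A) L := FractionRing.isScalarTower_liftAlgebra A L
  have : CharZero (FractionRing A) :=
    charZero_of_injective_algebraMap (IsFractionRing.injective A (FractionRing A))
  have : Algebra.IsAlgebraic (FractionRing A) L :=
    .extendScalars (IsFractionRing.injective A (FractionRing A))
  have : Algebra.FormallyEtale A (FractionRing A) := .of_isLocalization (nonZeroDivisors A)
  have : Algebra.FormallyEtale (FractionRing A) L := .of_isSeparable _ _
  exact .comp A (FractionRing A) L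

/-- In characteristic zero, algebraically independent elements of a field admit dual derivations. -/
theorem AlgebraicIndependent.exists_derivation {k L ι : Type*} [Field k] [CharZero k] [Field L]
    [Algebra k L] [DecidableEq ι] {x : ι → L} (hx : AlgebraicIndependent k x) (i : ι) :
    ∃ D : Derivation k L L, ∀ j, D (x j) = if i = j then 1 else 0 := by
  classical
  obtain ⟨t, hst, ht⟩ := exists_isTranscendenceBasis_superset
    ((algebraicIndependent_subtype_range hx.injective).2 hx)
  let f : MvPolynomial t k →ₐ[k] L := MvPolynomial.aeval ((↑) : t → L)
  let : Algebra (MvPolynomial t k) L := f.toRingHom.toAlgebra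
  have : IsScalarTower k (MvPolynomial t k) L := .of_algebraMap_eq fun a => (f.commutes a).symm
  have hf : Function.Injective (algebraMap (MvPolynomial t k) L) := ht.1
  have : FaithfulSMul (MvPolynomial t k) L := (faithfulSMul_iff_algebraMap_injective _ L).2 hf
  have hX (j : t) : (j : L) = algebraMap (MvPolynomial t k) L (MvPolynomial.X j) :=
    (MvPolynomial.aeval_X _ _).symm
  have : Algebra.IsAlgebraic (MvPolynomial t k) L := ht.isAlgebraic_iff.2 fun j => by
    rw [hX]; exact isAlgebraic_algebraMap _
  have : Algebra.FormallyEtale (MvPolynomial t k) L := .of_isAlgebraic_of_charZero _ _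
  -- The partial derivative along `x i` on the polynomial ring of a transcendence basis extends to
  -- `L`, which is algebraic over that ring.
  obtain ⟨D, hD⟩ := Derivation.exists_extension_of_formallyEtale
    (MvPolynomial.mkDerivation k (Pi.single (⟨x i, hst ⟨i, rfl⟩⟩ : t) (1 : L)))
  refine ⟨D, fun j => ?_⟩
  rw [show x j = _ from hX ⟨x j, hst ⟨j, rfl⟩⟩, hD, MvPolynomial.mkDerivation_X, Pi.single_apply]
  refine if_congr ?_ rfl rfl
  rw [Subtype.mk.injEq, hx.injective.eq_iff, eq_comm]

/-! ### Rank, minors and symmetric factorisation -/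

namespace Matrix

variable {F : Type*} [Field F]

theorem exists_linearIndependent_rows {ι κ τ : Type*} [Finite ι] [Fintype κ]
    [Fintype τ] (M : Matrix ι κ F) (h : Fintype.card τ ≤ M.rank) :
    ∃ f : τ → ι, LinearIndependent F (M.submatrix f id).row := by
  cases nonempty_fintype ι
  obtain ⟨α, a, ha, hspan, hli⟩ := exists_linearIndependent' F M.row
  have : Finite α := Finite.of_injective a ha
  cases nonempty_fintype α
  have hc : Fintype.card α = M.rank := by
    rw [rank_eq_finrank_span_row, ← hspan, finrank_span_eq_card hli]
  obtain ⟨e⟩ := Function.Embedding.nonempty_of_card_le (α := τ) (β := α) (hc ▸ h)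
  exact ⟨a ∘ e, hli.comp e e.injective⟩

/-- Turns injectivity into the nonvanishing of one determinant, a polynomial condition on the
entries. -/
theorem exists_isUnit_det_submatrix {ι κ : Type*} [Finite ι] [Fintype κ] [DecidableEq κ]
    (M : Matrix ι κ F) (h : Function.Injective M.mulVec) :
    ∃ f : κ → ι, IsUnit (M.submatrix f id).det := by
  cases nonempty_fintype ι
  have hr : Fintype.card κ ≤ M.rank := by
    rw [Matrix.rank, LinearMap.finrank_range_of_inj (f := M.mulVecLin) h]
    simp
  obtain ⟨f, hf⟩ := M.exists_linearIndependent_rows hr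
  exact ⟨f, (isUnit_iff_isUnit_det _).1 (linearIndependent_rows_iff_isUnit.1 hf)⟩

theorem rank_le_of_minors_eq_zero {m n k : ℕ} (M : Matrix (Fin m) (Fin n) F)
    (h : ∀ (r : Fin (k + 1) ↪o Fin m) (c : Fin (k + 1) ↪o Fin n), (M.submatrix r c).det = 0) :
    M.rank ≤ k := by
  by_contra! hk
  obtain ⟨f, hf⟩ := M.exists_linearIndependent_rows (τ := Fin (k + 1)) (by simpa using hk)
  -- The hypothesis covers only increasing selections of rows and columns, so the selections found
  -- are sorted.
  have hf' : LinearIndependent F (M.submatrix (f ∘ Tuple.sort f) id).row :=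
    hf.comp _ (Tuple.sort f).injective
  have hfi : Function.Injective f := fun a b hab => hf.injective (by ext j; simp [hab])
  obtain ⟨g, hg⟩ := (M.submatrix (f ∘ Tuple.sort f) id)ᵀ.exists_linearIndependent_rows
    (τ := Fin (k + 1)) (by rw [rank_transpose, hf'.rank_matrix])
  have hgi : Function.Injective g := fun a b hab => hg.injective (by ext j; simp [hab])
  have hg' : LinearIndependent F
      (M.submatrix (f ∘ Tuple.sort f) (g ∘ Tuple.sort g))ᵀ.row :=
    hg.comp _ (Tuple.sort g).injective
  have hu := (isUnit_iff_isUnit_det _).1 (linearIndependent_rows_iff_isUnit.1 hg')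
  rw [det_transpose] at hu
  exact hu.ne_zero (h
    (OrderEmbedding.ofStrictMono _ ((Tuple.monotone_sort f).strictMono_of_injective
      (hfi.comp (Tuple.sort f).injective)))
    (OrderEmbedding.ofStrictMono _ ((Tuple.monotone_sort g).strictMono_of_injective
      (hgi.comp (Tuple.sort g).injective))))

/-- Over an algebraically closed field of characteristic not two, a symmetric matrix of rank at
most `n` is of the form `Y * Yᵀ` with `Y` having `n` columns. -/
theorem IsSymm.exists_eq_mul_transpose [IsAlgClosed F] [NeZero (2 : F)] {m n : ℕ}
    {S : Matrix (Fin m) (Fin m) F} (hS : S.IsSymm) (hr : S.rank ≤ n) :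
    ∃ Y : Matrix (Fin m) (Fin n) F, S = Y * Yᵀ := by
  classical
  have : Invertible (2 : F) := invertibleOfNonzero two_ne_zero
  let B := toBilin' S
  have hB : LinearMap.IsSymm B := by
    refine ⟨fun x y => ?_⟩
    simp only [B, toBilin'_apply', RingHom.id_apply]
    rw [dotProduct_comm, ← vecMul_transpose, hS.eq, dotProduct_mulVec]
  obtain ⟨v, hv⟩ := LinearMap.BilinForm.exists_orthogonal_basis hB
  have hfin : Module.finrank F (Fin m → F) = m := by simp
  let b := v.reindex (finCongr hfin)
  have hb : ∀ i j, i ≠ j → B (b i) (b j) = 0 := fun i j hij => by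
    simp only [b, Module.Basis.reindex_apply]
    exact hv (by simpa using hij)
  let Q : Matrix (Fin m) (Fin m) F := (Pi.basisFun F (Fin m)).toMatrix b
  let R : Matrix (Fin m) (Fin m) F := b.toMatrix (Pi.basisFun F (Fin m))
  have hRQ : Q * R = 1 := Module.Basis.toMatrix_mul_toMatrix_flip _ _
  let d : Fin m → F := fun i => B (b i) (b i)
  have hD : Qᵀ * S * Q = diagonal d := by
    ext i j
    have h1 : (Qᵀ * S * Q) i j = B (b i) (b j) := by
      rw [Matrix.mul_assoc, toBilin'_apply']
      rfl
    rw [h1]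
    by_cases hij : i = j
    · subst hij; simp [d]
    · rw [hb i j hij, diagonal_apply_ne _ hij]
  have hSD : S = Rᵀ * diagonal d * R := by
    rw [← hD]
    calc S = (Q * R)ᵀ * S * (Q * R) := by simp [hRQ]
      _ = _ := by simp only [transpose_mul, Matrix.mul_assoc]
  have hcard : Fintype.card {i // d i ≠ 0} ≤ Fintype.card (Fin n) := by
    rw [← rank_diagonal, ← hD, Fintype.card_fin]
    exact ((rank_mul_le_left _ _).trans (rank_mul_le_right _ _)).trans hr
  obtain ⟨e⟩ := Function.Embedding.nonempty_of_card_le hcard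
  choose c hc using fun i => IsAlgClosed.exists_pow_nat_eq (d i) (n := 2) two_pos
  -- Square roots of the nonzero diagonal entries, each in its own column; the rank bound ensures
  -- that `n` columns suffice.
  let W : Matrix (Fin m) (Fin n) F := of fun i k => if h : d i ≠ 0 then
    if e ⟨i, h⟩ = k then c i else 0 else 0
  have hW : W * Wᵀ = diagonal d := by
    ext i j
    simp only [mul_apply, transpose_apply, W, of_apply, diagonal_apply]
    by_cases hi : d i = 0
    · by_cases hij : i = j
      · simp [hi, hij ▸ hi]
      · simp [hi, hij]
    by_cases hj : d j = 0
    · have : i ≠ j := fun h => hi (h ▸ hj)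
      simp [hj, this]
    simp only [ne_eq, hi, not_false_eq_true, dite_true, hj, ite_mul, zero_mul,
      Finset.sum_ite_eq, Finset.mem_univ, if_true, mul_ite, mul_zero, e.injective.eq_iff, Subtype.mk.injEq]
    split_ifs with hij
    · subst hij; rw [← hc, sq]
    · rfl
  refine ⟨Rᵀ * W, ?_⟩
  rw [hSD, ← hW, transpose_mul, transpose_transpose]
  simp only [Matrix.mul_assoc]

end Matrix

/-! ### The generic low-rank symmetric matrix and its annihilators -/

namespace GaussianGraphicalModel

/-- If the elimination ideal vanishes, some symmetric matrix of rank at most `n` over an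
algebraically closed extension of `ℝ` has algebraically independent entries at the edges. -/
theorem exists_generic_symm {m n : ℕ} (G : SimpleGraph (Fin m)) (hI : eliminationIdeal G n = ⊥) :
    ∃ (L : Type) (_ : Field L) (_ : Algebra ℝ L) (_ : IsAlgClosed L) (s : Sym2 (Fin m) → L),
      AlgebraicIndependent ℝ (fun e : edgesWithLoops G => s e) ∧
        (Matrix.of fun i j => s s(i, j)).rank ≤ n := by
  let ρ := MvPolynomial.rename (R := ℝ) (Subtype.val : edgesWithLoops G → Sym2 (Fin m))
  have hρ : Function.Injective ρ := MvPolynomial.rename_injective _ Subtype.val_injective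
  -- The minor ideal is not known to be prime here; a prime above it avoiding all nonzero edge
  -- polynomials is enough.
  let M : Submonoid (MvPolynomial (Sym2 (Fin m)) ℝ) :=
    (nonZeroDivisors (MvPolynomial (edgesWithLoops G) ℝ)).map ρ
  have hdisj : Disjoint (minorIdeal m (n + 1) : Set (MvPolynomial (Sym2 (Fin m)) ℝ)) M := by
    rw [Set.disjoint_left]
    rintro _ hp ⟨f, hf, rfl⟩
    have : f ∈ eliminationIdeal G n := hp
    rw [hI, Ideal.mem_bot] at this
    exact nonZeroDivisors.ne_zero hf this
  obtain ⟨P, hP, hle, hPM⟩ := Ideal.exists_le_prime_disjoint _ _ hdisj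
  let D := MvPolynomial (Sym2 (Fin m)) ℝ ⧸ P
  let L := AlgebraicClosure (FractionRing D)
  let φ : MvPolynomial (Sym2 (Fin m)) ℝ →ₐ[ℝ] L :=
    (IsScalarTower.toAlgHom ℝ D L).comp (Ideal.Quotient.mkₐ ℝ P)
  have hDL : Function.Injective (algebraMap D L) := by
    rw [IsScalarTower.algebraMap_eq D (FractionRing D) L]
    exact (algebraMap (FractionRing D) L).injective.comp (IsFractionRing.injective D _)
  have hφ : ∀ f, φ f = 0 → f ∈ P := fun f hf => by
    refine Ideal.Quotient.eq_zero_iff_mem.1 (?_ : Ideal.Quotient.mk P f = 0)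
    exact hDL (hf.trans (map_zero _).symm)
  refine ⟨L, inferInstance, inferInstance, inferInstance, fun e => φ (MvPolynomial.X e), ?_, ?_⟩
  · rw [AlgebraicIndependent, injective_iff_map_eq_zero]
    intro f hf
    have h1 : MvPolynomial.aeval (fun e : edgesWithLoops G => φ (MvPolynomial.X e.1)) f
        = φ (ρ f) := by
      rw [← AlgHom.comp_apply]
      congr 1
      ext e
      simp [ρ]
    rw [h1] at hf
    by_contra hne
    exact Set.disjoint_left.1 hPM (hφ _ hf) ⟨f, mem_nonZeroDivisors_of_ne_zero hne, rfl⟩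
  · refine Matrix.rank_le_of_minors_eq_zero _ fun r c => ?_
    have h1 : ((genericSymm m).submatrix r c).det ∈ P :=
      hle (Ideal.subset_span ⟨r, c, rfl⟩)
    have h2 : φ ((genericSymm m).submatrix r c).det = 0 := by
      simp only [φ, AlgHom.comp_apply]
      have : Ideal.Quotient.mkₐ ℝ P ((genericSymm m).submatrix r c).det = 0 :=
        Ideal.Quotient.eq_zero_iff_mem.2 h1
      rw [this, map_zero]
    rw [AlgHom.map_det] at h2
    exact h2

/-- The symmetric matrix with prescribed entries at `E` and zeros elsewhere. -/
noncomputable def symmOfSupport {m : ℕ} {R : Type*} [Zero R] (E : Set (Sym2 (Fin m))) (a : E → R) :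
    Matrix (Fin m) (Fin m) R :=
  open Classical in Matrix.of fun i j => if h : s(i, j) ∈ E then a ⟨s(i, j), h⟩ else 0

/-- The matrix of the linear map `a ↦ symmOfSupport E a * Y`. -/
noncomputable def symmMulMatrix {m n : ℕ} {R : Type*} [CommRing R] (E : Set (Sym2 (Fin m)))
    (Y : Matrix (Fin m) (Fin n) R) : Matrix (Fin m × Fin n) E R :=
  open Classical in Matrix.of fun p e => ∑ j, if s(p.1, j) = e then Y j p.2 else 0

theorem symmMulMatrix_mulVec {m n : ℕ} {R : Type*} [CommRing R] (E : Set (Sym2 (Fin m)))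
    [Fintype E] (Y : Matrix (Fin m) (Fin n) R) (a : E → R) (p : Fin m × Fin n) :
    (symmMulMatrix E Y *ᵥ a) p = (symmOfSupport E a * Y) p.1 p.2 := by
  classical
  simp only [symmMulMatrix, Matrix.mulVec, dotProduct, Matrix.of_apply, Finset.sum_mul,
    Matrix.mul_apply, symmOfSupport]
  rw [Finset.sum_comm]
  refine Finset.sum_congr rfl fun j _ => ?_
  split_ifs with h
  · rw [Finset.sum_eq_single ⟨s(p.1, j), h⟩]
    · simp [mul_comm]
    · intro e _ he
      rw [if_neg fun h' => he (Subtype.ext h'.symm), zero_mul]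
    · simp
  · rw [zero_mul]
    refine Finset.sum_eq_zero fun e _ => ?_
    rw [if_neg fun h' : s(p.1, j) = e => h (h' ▸ e.2), zero_mul]

theorem symmMulMatrix_map {m n : ℕ} {R R' : Type*} [CommRing R] [CommRing R']
    (E : Set (Sym2 (Fin m))) (φ : R →+* R') (Y : Matrix (Fin m) (Fin n) R) :
    (symmMulMatrix E Y).map φ = symmMulMatrix E (Y.map φ) := by
  ext p e
  simp [symmMulMatrix, apply_ite φ]

/-- If the entries of `Y * Yᵀ` at `E` are algebraically independent, then no nonzero symmetric
matrix supported at `E` annihilates `Y`. -/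
theorem eq_zero_of_symmOfSupport_mul_eq_zero {m n : ℕ} {k L : Type*} [Field k] [CharZero k]
    [Field L] [Algebra k L] (E : Set (Sym2 (Fin m))) (s : Sym2 (Fin m) → L)
    (hs : AlgebraicIndependent k (fun e : E => s e)) (Y : Matrix (Fin m) (Fin n) L)
    (hY : (Matrix.of fun i j => s s(i, j)) = Y * Yᵀ) (a : E → L)
    (ha : symmOfSupport E a * Y = 0) : a = 0 := by
  classical
  have : CharZero L := charZero_of_injective_algebraMap (algebraMap k L).injective
  funext e
  obtain ⟨D, hD⟩ := hs.exists_derivation e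
  have hsymm (i j : Fin m) : symmOfSupport E a i j = symmOfSupport E a j i := by
    simp only [symmOfSupport, Matrix.of_apply, Sym2.eq_swap (a := i) (b := j)]
  have ha' (i : Fin m) (l : Fin n) : ∑ j, symmOfSupport E a i j * Y j l = 0 := by
    simpa [Matrix.mul_apply] using congrFun (congrFun ha i) l
  have hDs (i j : Fin m) : D (s s(i, j)) = ∑ l, (Y i l * D (Y j l) + Y j l * D (Y i l)) := by
    have : s s(i, j) = ∑ l, Y i l * Y j l := by
      simpa [Matrix.mul_apply] using congrFun (congrFun hY i) j
    rw [this, map_sum]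
    simp only [Derivation.leibniz, smul_eq_mul]
  have h0 : ∑ i, ∑ j, symmOfSupport E a i j * D (s s(i, j)) = 0 := by
    simp only [hDs, Finset.mul_sum, mul_add, Finset.sum_add_distrib]
    have h1 : ∑ i, ∑ j, ∑ l, symmOfSupport E a i j * (Y j l * D (Y i l)) = 0 := by
      refine Finset.sum_eq_zero fun i _ => ?_
      rw [Finset.sum_comm]
      refine Finset.sum_eq_zero fun l _ => ?_
      simp only [← mul_assoc]
      rw [← Finset.sum_mul, ha', zero_mul]
    have h2 : ∑ i, ∑ j, ∑ l, symmOfSupport E a i j * (Y i l * D (Y j l)) = 0 := by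
      rw [Finset.sum_comm, ← h1]
      simp only [hsymm]
    rw [h1, h2, add_zero]
  -- Off `E` nothing is known about `D (s s(i, j))`, but its coefficient is zero there.
  have h3 (i j : Fin m) : symmOfSupport E a i j * D (s s(i, j)) =
      if s(i, j) = e then a e else 0 := by
    by_cases h : s(i, j) ∈ E
    · have := hD ⟨s(i, j), h⟩
      simp only at this
      rw [this]
      by_cases he : s(i, j) = e
      · have : e = ⟨s(i, j), h⟩ := Subtype.ext he.symm
        simp [symmOfSupport, this, h]
      · have : e ≠ ⟨s(i, j), h⟩ := fun h' => he (congrArg Subtype.val h').symm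
        simp [this, he]
    · have : s(i, j) ≠ e := fun h' => h (h' ▸ e.2)
      simp [symmOfSupport, h, this]
  simp only [h3] at h0
  -- The sum is `a e` times the number of ordered pairs representing `e`, which is nonzero in
  -- characteristic zero.
  rw [← Finset.sum_product', ← Finset.sum_filter, Finset.sum_const, smul_eq_zero] at h0
  refine h0.resolve_left ?_
  obtain ⟨⟨i, j⟩, hij⟩ := Sym2.mk_surjective (e : Sym2 (Fin m))
  exact Finset.card_ne_zero.2 ⟨(i, j), by simpa using hij⟩

theorem exists_eq_symmOfSupport {m : ℕ} {R : Type*} [Zero R] (E : Set (Sym2 (Fin m)))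
    (K : Matrix (Fin m) (Fin m) R) (hK : K.IsSymm) (hE : ∀ i j, s(i, j) ∉ E → K i j = 0) :
    ∃ a, K = symmOfSupport E a := by
  classical
  refine ⟨fun e => Sym2.lift ⟨fun i j => K i j, fun i j => hK.apply j i⟩ e, ?_⟩
  ext i j
  by_cases h : s(i, j) ∈ E
  · simp [symmOfSupport, h]
  · simp [symmOfSupport, h, hE]

/-- If the elimination ideal vanishes, then for generic `z` no nonzero symmetric matrix supported
on `G` annihilates all the vectors `A *ᵥ z k`. -/
theorem exists_polynomial_forall_mulVec_ne_zero {m n : ℕ} (G : SimpleGraph (Fin m))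
    (hI : eliminationIdeal G n = ⊥) (A : Matrix (Fin m) (Fin m) ℝ) (hA : IsUnit A.det) :
    ∃ p : MvPolynomial (Fin n × Fin m) ℝ, p ≠ 0 ∧ ∀ z : Fin n × Fin m → ℝ,
      MvPolynomial.eval z p ≠ 0 → ∀ K : Matrix (Fin m) (Fin m) ℝ, K.IsSymm →
        (∀ i j, i ≠ j → ¬ G.Adj i j → K i j = 0) →
        (∀ k, K *ᵥ (A *ᵥ fun i => z (k, i)) = 0) → K = 0 := by
  classical
  obtain ⟨L, _, _, _, s, hs, hr⟩ := exists_generic_symm G hI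
  have : CharZero L := charZero_of_injective_algebraMap (algebraMap ℝ L).injective
  have : Fintype (edgesWithLoops G) := Fintype.ofFinite _
  have hS : (Matrix.of fun i j => s s(i, j)).IsSymm := by
    ext i j
    simp [Sym2.eq_swap]
  obtain ⟨Y, hY⟩ := hS.exists_eq_mul_transpose hr
  have hinj : Function.Injective (symmMulMatrix (edgesWithLoops G) Y).mulVec := by
    refine (injective_iff_map_eq_zero (symmMulMatrix (edgesWithLoops G) Y).mulVecLin).2
      fun a ha => eq_zero_of_symmOfSupport_mul_eq_zero _ s hs Y hY a ?_
    ext i l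
    rw [← symmMulMatrix_mulVec _ Y a (i, l)]
    exact congrFun ha _
  obtain ⟨f, hf⟩ := Matrix.exists_isUnit_det_submatrix _ hinj
  let Z : Matrix (Fin m) (Fin n) (MvPolynomial (Fin n × Fin m) ℝ) :=
    A.map MvPolynomial.C * Matrix.of fun i k => MvPolynomial.X (k, i)
  refine ⟨((symmMulMatrix (edgesWithLoops G) Z).submatrix f id).det, ?_, ?_⟩
  · intro h0
    -- Substituting `A⁻¹ * Y` for the unknowns turns `Z` into `Y`, where the minor is nonzero; so it
    -- is a nonzero polynomial.
    let B : Matrix (Fin m) (Fin n) L := A⁻¹.map (algebraMap ℝ L) * Y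
    let φ : MvPolynomial (Fin n × Fin m) ℝ →+* L :=
      (MvPolynomial.aeval (R := ℝ) fun q : Fin n × Fin m => B q.2 q.1).toRingHom
    have hZ : Z.map φ = Y := by
      have h1 : (A.map MvPolynomial.C).map φ = A.map (algebraMap ℝ L) := by
        ext i j; simp [φ]
      have h2 : (Matrix.of fun i k => (MvPolynomial.X (k, i) :
          MvPolynomial (Fin n × Fin m) ℝ)).map φ = B := by
        ext i j; simp [φ]
      have h3 : Z.map φ = A.map (algebraMap ℝ L) * B := by
        rw [← h1, ← h2]; exact Matrix.map_mul
      rw [h3, ← Matrix.mul_assoc, ← Matrix.map_mul, Matrix.mul_nonsing_inv _ hA]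
      simp
    apply hf.ne_zero
    rw [← hZ, ← symmMulMatrix_map, Matrix.submatrix_map]
    have := congrArg φ h0
    rwa [map_zero, RingHom.map_det] at this
  · intro z hz K hK hKG hKz
    obtain ⟨a, rfl⟩ := exists_eq_symmOfSupport (edgesWithLoops G) K hK fun i j hij => by
      simp only [edgesWithLoops, Set.mem_ofPred_eq, Sym2.mk_isDiag_iff, SimpleGraph.mem_edgeSet,
        not_or] at hij
      exact hKG i j hij.1 hij.2
    let W : Matrix (Fin m) (Fin n) ℝ := A * Matrix.of fun i k => z (k, i)
    have hZ : Z.map (MvPolynomial.eval z) = W := by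
      refine (Matrix.map_mul (f := MvPolynomial.eval z)).trans ?_
      congr 1
      · ext i j; simp
      · ext i j; simp
    rw [RingHom.map_det] at hz
    have hz' : ((symmMulMatrix (edgesWithLoops G) W).submatrix f id).det ≠ 0 := by
      rwa [← hZ, ← symmMulMatrix_map, Matrix.submatrix_map]
    have ha : a = 0 := by
      refine Matrix.eq_zero_of_mulVec_eq_zero hz' ?_
      ext e
      change (symmMulMatrix (edgesWithLoops G) W *ᵥ a) (f e) = 0
      rw [symmMulMatrix_mulVec]
      have := congrFun (hKz (f e).2) (f e).1
      rw [Matrix.mulVec_mulVec] at this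
      rw [← Matrix.mul_assoc]
      exact this
    ext i j
    simp [symmOfSupport, ha]

end GaussianGraphicalModel

/-! ### Zero sets of polynomials are null -/

namespace MvPolynomial

theorem measurable_eval {ι : Type*} (p : MvPolynomial ι ℝ) :
    Measurable fun x : ι → ℝ => eval x p := by
  induction p using MvPolynomial.induction_on with
  | C a => simp
  | add p q hp hq => simp only [map_add]; exact hp.add hq
  | mul_X p i hp => simp only [map_mul, eval_X]; exact hp.mul (measurable_pi_apply i)

theorem measurableSet_eval_ne_zero {ι : Type*} (p : MvPolynomial ι ℝ) :
    MeasurableSet {x : ι → ℝ | eval x p ≠ 0} :=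
  p.measurable_eval (measurableSet_singleton 0).compl

/-- A nonzero polynomial is almost everywhere nonzero for a product of atomless measures. -/
theorem ae_eval_ne_zero_fin {d : ℕ} (μ : Fin d → Measure ℝ) [∀ i, SigmaFinite (μ i)]
    [∀ i, NullSingletonClass (μ i)] (p : MvPolynomial (Fin d) ℝ) (hp : p ≠ 0) :
    ∀ᵐ x ∂Measure.pi μ, eval x p ≠ 0 := by
  induction d with
  | zero =>
    obtain ⟨c, rfl⟩ := C_surjective (Fin 0) p
    have hc : c ≠ 0 := fun h => hp (by simp [h])
    simp [hc]
  | succ d ih =>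
    let q := finSuccEquiv ℝ d p
    have hq : q ≠ 0 := by simpa [q] using hp
    have he := (measurePreserving_piFinSuccAbove μ 0).symm
    rw [← he.map_eq, ae_map_iff he.measurable.aemeasurable p.measurableSet_eval_ne_zero]
    have hms : MeasurableSet {y : ℝ × (Fin d → ℝ) |
        eval ((MeasurableEquiv.piFinSuccAbove (fun _ => ℝ) 0).symm y) p ≠ 0} :=
      he.measurable p.measurableSet_eval_ne_zero
    have hswap : ∀ᵐ y ∂(Measure.pi fun j => μ (Fin.succAbove 0 j)).prod (μ 0),
        eval ((MeasurableEquiv.piFinSuccAbove (fun _ => ℝ) 0).symm y.swap) p ≠ 0 := by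
      -- Fubini with the first variable innermost: where the leading coefficient is nonzero, only
      -- finitely many values of that variable are roots.
      refine (Measure.ae_prod_iff_ae_ae (measurable_swap hms)).2 ?_
      filter_upwards [ih (fun j => μ (Fin.succAbove 0 j)) q.leadingCoeff
        (Polynomial.leadingCoeff_ne_zero.2 hq)] with x hx
      have hqx : q.map (eval x) ≠ 0 := fun h => hx (by
        have := congrArg (Polynomial.coeff · q.natDegree) h
        simpa using this)
      have hfin : {t : ℝ | Polynomial.eval t (q.map (eval x)) = 0}.Finite := by
        refine (q.map (eval x)).roots.toFinset.finite_toSet.subset fun t ht => ?_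
        simpa [hqx] using ht
      filter_upwards [measure_eq_zero_iff_ae_notMem.1 (hfin.measure_zero (μ 0))] with t ht
      have : (MeasurableEquiv.piFinSuccAbove (fun _ : Fin (d + 1) => ℝ) 0).symm (t, x)
          = Fin.cons t x := by
        simp [MeasurableEquiv.piFinSuccAbove, Fin.insertNthEquiv]
      simp only [Prod.swap_prod_mk]
      rw [this, eval_eq_eval_mv_eval']
      exact ht
    rw [← Measure.prod_swap, ae_map_iff measurable_swap.aemeasurable hms]
    exact hswap

theorem ae_eval_ne_zero {ι : Type*} [Fintype ι] (μ : ι → Measure ℝ) [∀ i, SigmaFinite (μ i)]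
    [∀ i, NullSingletonClass (μ i)] (p : MvPolynomial ι ℝ) (hp : p ≠ 0) :
    ∀ᵐ x ∂Measure.pi μ, eval x p ≠ 0 := by
  let e := Fintype.equivFin ι
  have he := measurePreserving_piCongrLeft μ e.symm
  rw [← he.map_eq, ae_map_iff he.measurable.aemeasurable p.measurableSet_eval_ne_zero]
  have hq : rename e p ≠ 0 := fun h => hp (rename_injective _ e.injective (by simpa using h))
  filter_upwards [ae_eval_ne_zero_fin (fun i => μ (e.symm i)) _ hq] with x hx
  rw [eval_rename] at hx
  convert hx using 3
  ext i
  obtain ⟨j, rfl⟩ := e.symm.surjective i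
  simp [MeasurableEquiv.piCongrLeft, Equiv.piCongrLeft_apply_apply]

end MvPolynomial

/-! ### Joint law of the Gaussian sample -/

theorem MeasureTheory.Measure.map_uncurry_pi {ι κ : Type*} [Fintype ι] [Fintype κ]
    {α : Type*} [MeasurableSpace α] (μ : Measure α) [SigmaFinite μ] :
    (Measure.pi fun _ : ι => Measure.pi fun _ : κ => μ).map (fun z (q : ι × κ) => z q.1 q.2)
      = Measure.pi fun _ : ι × κ => μ := by
  refine (Measure.pi_eq fun s hs => ?_).symm
  rw [Measure.map_apply (by fun_prop) (.univ_pi hs)]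
  have : (fun (z : ι → κ → α) (q : ι × κ) => z q.1 q.2) ⁻¹' Set.univ.pi s
      = Set.univ.pi fun i => Set.univ.pi fun j => s (i, j) := by
    ext z; simp [Set.mem_pi]
  rw [this, Measure.pi_pi, Fintype.prod_prod_type]
  simp [Measure.pi_pi]

namespace ProbabilityTheory

open scoped MatrixOrder in
/-- The joint law of independent centred Gaussian vectors is the image of a product of standard
real Gaussian measures under a linear map. -/
theorem map_eq_map_pi_gaussianReal {m n : ℕ} {Ω : Type*} [MeasurableSpace Ω] {P : Measure Ω}
    [IsProbabilityMeasure P] (S₀ : Matrix (Fin m) (Fin m) ℝ)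
    (X : Fin n → Ω → EuclideanSpace ℝ (Fin m)) (hindep : iIndepFun X P)
    (hlaw : ∀ k, HasLaw (X k) (multivariateGaussian 0 S₀) P) :
    P.map (fun ω k => X k ω) =
      (Measure.pi fun _ : Fin n => Measure.pi fun _ : Fin m => gaussianReal 0 1).map
        fun z k => WithLp.toLp 2 (CFC.sqrt S₀ *ᵥ z k) := by
  rw [(iIndepFun_iff_map_fun_eq_pi_map fun k => (hlaw k).aemeasurable).1 hindep]
  have hf : Measurable fun z : Fin m → ℝ =>
      (WithLp.toLp 2 (CFC.sqrt S₀ *ᵥ z) : EuclideanSpace ℝ (Fin m)) := by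
    fun_prop
  have h : multivariateGaussian 0 S₀ = (Measure.pi fun _ : Fin m => gaussianReal 0 1).map
      fun z => WithLp.toLp 2 (CFC.sqrt S₀ *ᵥ z) := by
    rw [multivariateGaussian, ← map_pi_eq_stdGaussian, Measure.map_map (by fun_prop) (by fun_prop)]
    congr 1
    ext z : 1
    simp
  simp only [(hlaw _).map_eq, h]
  rw [Measure.pi_map_pi fun _ => hf.aemeasurable]

end ProbabilityTheory

/-! ### Coercivity and existence of the maximum -/

namespace GaussianGraphicalModel

/-- The positive semidefinite matrices vanishing at all non-edges of `G`. -/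
def precisionCone {m : ℕ} (G : SimpleGraph (Fin m)) : Set (Matrix (Fin m) (Fin m) ℝ) :=
  {K | K.PosSemidef ∧ ∀ i j, i ≠ j → ¬ G.Adj i j → K i j = 0}

theorem isClosed_precisionCone {m : ℕ} (G : SimpleGraph (Fin m)) :
    IsClosed (precisionCone G) := by
  have h : precisionCone G = {K | K.conjTranspose = K} ∩
      (⋂ x : Fin m → ℝ, {K | 0 ≤ star x ⬝ᵥ (K *ᵥ x)}) ∩
      (⋂ i, ⋂ j, {K | i ≠ j → ¬ G.Adj i j → K i j = 0}) := by
    ext K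
    simp only [precisionCone, Matrix.posSemidef_iff_dotProduct_mulVec, Matrix.IsHermitian,
      Set.mem_inter_iff, Set.mem_iInter, Set.mem_ofPred_eq]
  rw [h]
  refine ((isClosed_eq (by fun_prop) (by fun_prop)).inter
    (isClosed_iInter fun x => isClosed_le (by fun_prop) (by fun_prop))).inter
    (isClosed_iInter fun i => isClosed_iInter fun j => ?_)
  by_cases hij : i ≠ j ∧ ¬ G.Adj i j
  · simp only [hij.1, hij.2, not_false_eq_true, ne_eq, forall_const]
    exact isClosed_eq (by fun_prop) (by fun_prop)
  · convert isClosed_univ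
    rw [Set.eq_univ_iff_forall]
    exact fun K h1 h2 => absurd ⟨h1, h2⟩ hij

theorem smul_mem_precisionCone {m : ℕ} {G : SimpleGraph (Fin m)} {K : Matrix (Fin m) (Fin m) ℝ}
    (hK : K ∈ precisionCone G) {c : ℝ} (hc : 0 ≤ c) : c • K ∈ precisionCone G :=
  ⟨hK.1.smul hc, fun i j hij h => by simp [hK.2 i j hij h]⟩

/-- The quadratic term `∑ xₖᵀ K xₖ` of the log-likelihood. -/
def quadTerm {m n : ℕ} (x : Fin n → EuclideanSpace ℝ (Fin m)) (K : Matrix (Fin m) (Fin m) ℝ) : ℝ :=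
  ∑ k, (x k).ofLp ⬝ᵥ (K *ᵥ (x k).ofLp)

/-- The likelihood as a function of the precision matrix `K`. -/
noncomputable def precisionLikelihood {m n : ℕ} (x : Fin n → EuclideanSpace ℝ (Fin m))
    (K : Matrix (Fin m) (Fin m) ℝ) : ℝ :=
  ((Real.sqrt ((2 * Real.pi) ^ m))⁻¹ * Real.sqrt K.det) ^ n * Real.exp (-quadTerm x K / 2)

theorem likelihood_inv {m n : ℕ} (x : Fin n → EuclideanSpace ℝ (Fin m))
    {K : Matrix (Fin m) (Fin m) ℝ} (hK : K.PosDef) :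
    likelihood x K⁻¹ = precisionLikelihood x K := by
  have hdet : IsUnit K.det := (Matrix.isUnit_iff_isUnit_det K).1 hK.isUnit
  simp only [likelihood, gaussianDensity, precisionLikelihood, quadTerm, Finset.prod_mul_distrib,
    Finset.prod_const, Finset.card_univ, Fintype.card_fin, ← Real.exp_sum,
    Matrix.nonsing_inv_nonsing_inv K hdet, Matrix.det_nonsing_inv, Ring.inverse_eq_inv']
  congr 2
  · rw [Real.sqrt_mul (by positivity), Real.sqrt_inv, mul_inv, inv_inv]
  · rw [← Finset.sum_div, Finset.sum_neg_distrib]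

theorem continuous_precisionLikelihood {m n : ℕ} (x : Fin n → EuclideanSpace ℝ (Fin m)) :
    Continuous (precisionLikelihood x) := by
  unfold precisionLikelihood quadTerm
  fun_prop

theorem precisionLikelihood_pos {m n : ℕ} (x : Fin n → EuclideanSpace ℝ (Fin m))
    {K : Matrix (Fin m) (Fin m) ℝ} (hK : K.PosDef) : 0 < precisionLikelihood x K := by
  have := Real.sqrt_pos.2 hK.det_pos
  unfold precisionLikelihood
  positivity

open scoped Matrix.Norms.Elementwise

/-- If no nonzero symmetric matrix supported on `G` annihilates the observations, the quadratic
term is coercive on the cone of precision matrices. -/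
theorem exists_pos_mul_norm_le_quadTerm {m n : ℕ} (G : SimpleGraph (Fin m))
    (x : Fin n → EuclideanSpace ℝ (Fin m))
    (h : ∀ K : Matrix (Fin m) (Fin m) ℝ, K.IsSymm →
        (∀ i j, i ≠ j → ¬ G.Adj i j → K i j = 0) → (∀ k, K *ᵥ (x k).ofLp = 0) → K = 0) :
    ∃ c > 0, ∀ K ∈ precisionCone G, c * ‖K‖ ≤ quadTerm x K := by
  have hcpt : IsCompact (precisionCone G ∩ Metric.sphere 0 1) :=
    (isCompact_sphere _ _).inter_left (isClosed_precisionCone G)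
  have hpos : ∀ K ∈ precisionCone G ∩ Metric.sphere 0 1, 0 < quadTerm x K := by
    rintro K ⟨hK, hK1⟩
    have hnn : ∀ k, 0 ≤ (x k).ofLp ⬝ᵥ (K *ᵥ (x k).ofLp) := fun k => by
      simpa using hK.1.dotProduct_mulVec_nonneg (x k).ofLp
    refine lt_of_le_of_ne (Finset.sum_nonneg fun k _ => hnn k) fun h0 => ?_
    have hz := (Finset.sum_eq_zero_iff_of_nonneg fun k _ => hnn k).1 h0.symm
    -- For positive semidefinite `K`, `xᵀ K x = 0` forces `K x = 0`.
    have : K = 0 := h K (by simpa [Matrix.IsSymm] using hK.1.1.eq) hK.2 fun k =>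
      (hK.1.dotProduct_mulVec_zero_iff _).1 (by simpa using hz k (Finset.mem_univ k))
    simp [this] at hK1
  obtain ⟨c, hc, hcK⟩ := hcpt.exists_forall_le' (f := quadTerm x)
    (by unfold quadTerm; fun_prop) hpos
  refine ⟨c, hc, fun K hK => ?_⟩
  rcases eq_or_ne K 0 with rfl | hK0
  · simp [quadTerm]
  have hn : 0 < ‖K‖ := norm_pos_iff.2 hK0
  have := hcK (‖K‖⁻¹ • K) ⟨smul_mem_precisionCone hK (by positivity), by
    simp [norm_smul, hn.ne']⟩
  have hq : quadTerm x (‖K‖⁻¹ • K) = ‖K‖⁻¹ * quadTerm x K := by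
    simp [quadTerm, Matrix.smul_mulVec, Finset.mul_sum]
  rw [hq, ← div_eq_inv_mul, le_div_iff₀ hn] at this
  exact this

/-- The determinant grows at most polynomially in `‖K‖`, while coercivity makes the exponential
factor decay exponentially. -/
theorem precisionLikelihood_le {m n : ℕ} (G : SimpleGraph (Fin m))
    (x : Fin n → EuclideanSpace ℝ (Fin m)) {c : ℝ}
    (hc : ∀ K ∈ precisionCone G, c * ‖K‖ ≤ quadTerm x K) {K : Matrix (Fin m) (Fin m) ℝ}
    (hK : K ∈ precisionCone G) (h1 : 1 ≤ ‖K‖) :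
    precisionLikelihood x K ≤ ((Real.sqrt ((2 * Real.pi) ^ m))⁻¹ * (1 + (m.factorial : ℝ))) ^ n *
      (‖K‖ ^ (m * n) / Real.exp (c / 2 * ‖K‖)) := by
  have hdet : K.det ≤ m.factorial * ‖K‖ ^ m := by
    have := Matrix.det_le (A := K) (abv := AbsoluteValue.abs) (x := ‖K‖)
      fun i j => Matrix.norm_entry_le_entrywise_sup_norm K
    simpa using (le_abs_self _).trans this
  have hp : (1 : ℝ) ≤ ‖K‖ ^ m := one_le_pow₀ h1
  have hsqrt : Real.sqrt K.det ≤ (1 + (m.factorial : ℝ)) * ‖K‖ ^ m := by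
    refine Real.sqrt_le_iff.2 ⟨by positivity, hdet.trans ?_⟩
    have hf : (0 : ℝ) ≤ m.factorial := by positivity
    nlinarith [mul_nonneg hf hf, mul_nonneg hf (sub_nonneg.2 hp), mul_self_nonneg (‖K‖ ^ m),
      mul_nonneg (mul_nonneg hf (zero_le_one.trans hp)) (sub_nonneg.2 hp),
      mul_nonneg (mul_nonneg hf hf) (mul_self_nonneg (‖K‖ ^ m))]
  have hexp : Real.exp (-quadTerm x K / 2) ≤ (Real.exp (c / 2 * ‖K‖))⁻¹ := by
    rw [← Real.exp_neg, Real.exp_le_exp]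
    linarith [hc K hK]
  calc precisionLikelihood x K
      ≤ ((Real.sqrt ((2 * Real.pi) ^ m))⁻¹ * ((1 + (m.factorial : ℝ)) * ‖K‖ ^ m)) ^ n *
        (Real.exp (c / 2 * ‖K‖))⁻¹ := by
        unfold precisionLikelihood
        gcongr
    _ = _ := by rw [← mul_assoc, mul_pow, ← pow_mul, mul_assoc, ← div_eq_mul_inv]

/-- The likelihood attains its maximum if no nonzero symmetric matrix supported on `G`
annihilates all the observations. -/
theorem mleExists_of_forall_mulVec_ne_zero {m n : ℕ} (G : SimpleGraph (Fin m))
    (x : Fin n → EuclideanSpace ℝ (Fin m)) {S₀ : Matrix (Fin m) (Fin m) ℝ} (hS₀ : S₀ ∈ covModel G)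
    (h : ∀ K : Matrix (Fin m) (Fin m) ℝ, K.IsSymm →
        (∀ i j, i ≠ j → ¬ G.Adj i j → K i j = 0) → (∀ k, K *ᵥ (x k).ofLp = 0) → K = 0) :
    MLEExists G x := by
  -- Without observations the likelihood is constantly `1`; the positivity argument for `det K`
  -- below needs `n > 0`.
  rcases Nat.eq_zero_or_pos n with rfl | hn
  · exact ⟨S₀, hS₀, fun S _ => by simp [likelihood]⟩
  obtain ⟨c, hc, hcK⟩ := exists_pos_mul_norm_le_quadTerm G x h
  have hmem (S) (hS : S ∈ covModel G) : S⁻¹ ∈ precisionCone G := ⟨hS.1.inv.posSemidef, hS.2⟩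
  have hlim : Filter.Tendsto (fun r : ℝ =>
      ((Real.sqrt ((2 * Real.pi) ^ m))⁻¹ * (1 + (m.factorial : ℝ))) ^ n *
        (r ^ (m * n) / Real.exp (c / 2 * r))) Filter.atTop (nhds 0) := by
    simpa using (isLittleO_pow_exp_pos_mul_atTop (m * n) (half_pos hc)).tendsto_div_nhds_zero.const_mul
      (((Real.sqrt ((2 * Real.pi) ^ m))⁻¹ * (1 + (m.factorial : ℝ))) ^ n)
  have hev : ∀ᶠ K in Filter.cocompact (Matrix (Fin m) (Fin m) ℝ) ⊓
      Filter.principal (precisionCone G),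
      precisionLikelihood x K ≤ precisionLikelihood x S₀⁻¹ := by
    rw [Filter.eventually_inf_principal]
    filter_upwards [(tendsto_norm_cocompact_atTop (E := Matrix (Fin m) (Fin m) ℝ)).eventually
      (hlim.eventually_le_const (precisionLikelihood_pos x hS₀.1.inv)),
      (tendsto_norm_cocompact_atTop (E := Matrix (Fin m) (Fin m) ℝ)).eventually_ge_atTop 1]
      with K hK1 hK2 hK
    exact (precisionLikelihood_le G x hcK hK hK2).trans hK1
  obtain ⟨K, hK, hmax⟩ := (continuous_precisionLikelihood x).continuousOn.exists_isMaxOn'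
    (isClosed_precisionCone G) (hmem _ hS₀) hev
  have hpos : 0 < precisionLikelihood x K :=
    (precisionLikelihood_pos x hS₀.1.inv).trans_le (hmax (hmem _ hS₀))
  -- The likelihood vanishes at singular `K`, so the maximiser over the closed cone is positive
  -- definite.
  have hdet : K.det ≠ 0 := fun h0 => by
    simp [precisionLikelihood, h0, hn.ne'] at hpos
  have hKpd : K.PosDef := hK.1.posDef_iff_det_ne_zero.2 hdet
  refine ⟨K⁻¹, ⟨hKpd.inv, ?_⟩, fun S hS => ?_⟩
  · rw [Matrix.nonsing_inv_nonsing_inv K hdet.isUnit]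
    exact hK.2
  · have hSdet : IsUnit S.det := (Matrix.isUnit_iff_isUnit_det S).1 hS.1.isUnit
    have := hmax (hmem S hS)
    simp only [Set.mem_ofPred_eq] at this ⊢
    rwa [← likelihood_inv x hS.1.inv, ← likelihood_inv x hKpd,
      Matrix.nonsing_inv_nonsing_inv S hSdet] at this

end GaussianGraphicalModel

/-! ### Almost sure conclusion -/

open scoped MatrixOrder in
theorem Matrix.PosDef.isUnit_det_sqrt {m : ℕ} {S : Matrix (Fin m) (Fin m) ℝ} (hS : S.PosDef) :
    IsUnit (CFC.sqrt S).det := by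
  have h : (CFC.sqrt S).det * (CFC.sqrt S).det = S.det := by
    rw [← Matrix.det_mul, CFC.sqrt_mul_sqrt_self S hS.posSemidef.nonneg]
  exact (left_ne_zero_of_mul (h ▸ hS.det_pos.ne')).isUnit

open scoped MatrixOrder in
/-- If the elimination ideal vanishes, almost surely no nonzero symmetric matrix supported on `G`
annihilates all the observations. -/
theorem GaussianGraphicalModel.ae_forall_mulVec_ne_zero {m n : ℕ} (G : SimpleGraph (Fin m))
    (hI : eliminationIdeal G n = ⊥) {Ω : Type*} [MeasurableSpace Ω] (P : Measure Ω)
    [IsProbabilityMeasure P] (S₀ : Matrix (Fin m) (Fin m) ℝ) (hS₀ : S₀.PosDef)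
    (X : Fin n → Ω → EuclideanSpace ℝ (Fin m)) (hindep : iIndepFun X P)
    (hlaw : ∀ k, HasLaw (X k) (multivariateGaussian 0 S₀) P) :
    ∀ᵐ ω ∂P, ∀ K : Matrix (Fin m) (Fin m) ℝ, K.IsSymm →
      (∀ i j, i ≠ j → ¬ G.Adj i j → K i j = 0) → (∀ k, K *ᵥ (X k ω).ofLp = 0) → K = 0 := by
  have hA := hS₀.isUnit_det_sqrt
  obtain ⟨p, hp, hpz⟩ := exists_polynomial_forall_mulVec_ne_zero G hI _ hA
  have hz : ∀ᵐ z ∂(Measure.pi fun _ : Fin n => Measure.pi fun _ : Fin m => gaussianReal 0 1),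
      MvPolynomial.eval (fun q : Fin n × Fin m => z q.1 q.2) p ≠ 0 := by
    have : NullSingletonClass (gaussianReal 0 1) := nullSingletonClass_gaussianReal one_ne_zero
    have := MvPolynomial.ae_eval_ne_zero (fun _ : Fin n × Fin m => gaussianReal 0 1) p hp
    rw [← Measure.map_uncurry_pi] at this
    exact ae_of_ae_map (f := fun (z : Fin n → Fin m → ℝ) (q : Fin n × Fin m) => z q.1 q.2)
      (by fun_prop : Measurable _).aemeasurable this
  -- The invertible square root of `S₀` lets the condition on the standard Gaussian vectors be read
  -- off from the observations.
  have hy : ∀ᵐ y ∂P.map (fun ω k => X k ω),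
      MvPolynomial.eval
        (fun q : Fin n × Fin m => ((CFC.sqrt S₀)⁻¹ *ᵥ (y q.1).ofLp) q.2) p ≠ 0 := by
    have hm : Measurable fun (y : Fin n → EuclideanSpace ℝ (Fin m)) (q : Fin n × Fin m) =>
        ((CFC.sqrt S₀)⁻¹ *ᵥ (y q.1).ofLp) q.2 :=
      (by fun_prop : Continuous _).measurable
    rw [map_eq_map_pi_gaussianReal S₀ X hindep hlaw]
    refine (ae_map_iff (by fun_prop : Continuous _).measurable.aemeasurable
      (hm p.measurableSet_eval_ne_zero)).2 ?_
    filter_upwards [hz] with z hz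
    simpa [Matrix.mulVec_mulVec, Matrix.nonsing_inv_mul _ hA] using hz
  filter_upwards [ae_of_ae_map (aemeasurable_pi_lambda _ fun k => (hlaw k).aemeasurable) hy]
    with ω hω K hK hKG hKX
  refine hpz _ hω K hK hKG fun k => ?_
  have : (CFC.sqrt S₀ *ᵥ fun i => ((CFC.sqrt S₀)⁻¹ *ᵥ (X k ω).ofLp) i) = (X k ω).ofLp := by
    change CFC.sqrt S₀ *ᵥ ((CFC.sqrt S₀)⁻¹ *ᵥ (X k ω).ofLp) = _
    rw [Matrix.mulVec_mulVec, Matrix.mul_nonsing_inv _ hA, Matrix.one_mulVec]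
  rw [this]
  exact hKX k

theorem theorem3p3 {m n : ℕ} (G : SimpleGraph (Fin m))
    (hI : GaussianGraphicalModel.eliminationIdeal G n = ⊥)
    {Ω : Type*} [MeasurableSpace Ω] (P : Measure Ω) [IsProbabilityMeasure P]
    (S₀ : Matrix (Fin m) (Fin m) ℝ) (hS₀ : S₀ ∈ GaussianGraphicalModel.covModel G)
    (X : Fin n → Ω → EuclideanSpace ℝ (Fin m))
    (hindep : iIndepFun X P)
    (hlaw : ∀ k, HasLaw (X k) (multivariateGaussian 0 S₀) P) :
    ∀ᵐ ω ∂P, GaussianGraphicalModel.MLEExists G (fun k => X k ω) := by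
  filter_upwards [GaussianGraphicalModel.ae_forall_mulVec_ne_zero G hI P S₀ hS₀.1 X hindep hlaw]
    with ω hω
  exact GaussianGraphicalModel.mleExists_of_forall_mulVec_ne_zero G _ hS₀ hω
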